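/- A linear order $L$ is c.c.c. if every family of pairwise disjoint nonempty open intervals of $L$ is countable, where the open intervals of $L$ are the sets $(a,b)=\{z\in L: a<z<b\}$ with $a,b\in L\cup\{-\infty,\infty\}$. The interval algebra $B(L)$ of $L$ is the subalgebra of the power set algebra $\mathcal P(L)$ generated by the intervals $[x,y)$ with $x,y\in L$, $x<y$. A tree is a partial order in which the set of strict predecessors of every element is well-ordered; the height of an element is the order type of this set, the $\alpha$-th level is the set of elements of height $\alpha$, and the height of the tree is the least $\alpha$ whose level is empty. A tree is Aronszajn if it is of height $\omega_1$, has only countable levels, and does not include an uncountable chain. Lemma. There is a dense linear order $L$ of size $\aleph_1$ without endpoints and with the following properties: (i) $L$ has no strictly increasing and no strictly decreasing sequences of length $\omega_1$. (ii) $L$ is isomorphic to every one of its nonempty open intervals. (iii) $L$ is not c.c.c. (iv) $B(L)$ has a subset $S$ which, ordered by $\supseteq$ (so that $a$ lies below $b$ if $a\supseteq b$), is an Aronszajn tree, and in which any two $\subseteq$-incomparable elements are disjoint. -/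

import Mathlib

/-- A partial order is a (set-theoretic) tree if the set of strict predecessors of every element
is well-ordered by `<`. -/
class IsTreeOrder (T : Type*) [PartialOrder T] : Prop where
  isWellOrder_Iio : ∀ x : T, IsWellOrder (Set.Iio x) (· < ·)

attribute [instance] IsTreeOrder.isWellOrder_Iio

/-- The height of a node `x` of a tree: the order type of its set of strict predecessors. -/
noncomputable def nodeHeight {T : Type*} [PartialOrder T] [IsTreeOrder T] (x : T) : Ordinal :=
  Ordinal.type (fun a b : Set.Iio x => a < b)

/-- The `α`-th level of a tree: the set of nodes of height `α`. -/
def treeLevel (T : Type*) [PartialOrder T] [IsTreeOrder T] (α : Ordinal) : Set T :=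
  {x | nodeHeight x = α}

/-- The height of a tree: the least ordinal `α` such that the `α`-th level is empty. -/
noncomputable def treeHeight (T : Type*) [PartialOrder T] [IsTreeOrder T] : Ordinal :=
  sInf {α | treeLevel T α = ∅}

/-- An Aronszajn tree: a tree of height `ω₁` all of whose levels are countable and which does not
include an uncountable chain. -/
def IsAronszajnTree (T : Type*) [PartialOrder T] : Prop :=
  ∃ _ : IsTreeOrder T,
    treeHeight T = Ordinal.omega 1 ∧
    (∀ α : Ordinal, (treeLevel T α).Countable) ∧
    (∀ C : Set T, IsChain (· ≤ ·) C → C.Countable)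

/-- The open intervals of a linear order: `(a, b)` with `a, b ∈ L ∪ {-∞, ∞}`. -/
def IsOpenInterval {L : Type*} [LinearOrder L] (s : Set L) : Prop :=
  (∃ a b : L, s = Set.Ioo a b) ∨ (∃ a : L, s = Set.Ioi a) ∨ (∃ b : L, s = Set.Iio b) ∨
    s = Set.univ

/-- A linear order is c.c.c. if every family of pairwise disjoint nonempty open intervals is
countable. -/
def IsCCCOrder (L : Type*) [LinearOrder L] : Prop :=
  ∀ F : Set (Set L), (∀ s ∈ F, s.Nonempty ∧ IsOpenInterval s) → F.PairwiseDisjoint id →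
    F.Countable

/-- The interval algebra of a linear order `L`: the subalgebra of the power set algebra of `L`
generated by the intervals `[x, y)`, `x < y`. -/
def intervalAlgebra (L : Type*) [LinearOrder L] : BooleanSubalgebra (Set L) :=
  BooleanSubalgebra.closure {s | ∃ x y : L, x < y ∧ s = Set.Ico x y}

/-! An ordered field is dense, has no endpoints and is isomorphic to each of its nonempty open
intervals. So it suffices to find an ordered field of size `ℵ₁`, without monotone `ω₁`-sequences,
whose order carries an Aronszajn tree of half-open intervals.

Start from a coherent sequence of finite-to-one functions on the countable ordinals. All finite
modifications of its members, extended by zero and ordered lexicographically, form a line `A`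
(`lexLine`). A monotone `ω₁`-sequence in `A` would stabilize to a cofinal branch, which
finite-to-one functions rule out (`IsCoherentSeq.noUncountableWO`). The functions extending a given
restriction form a half-open interval, and these intervals form an Aronszajn tree.

Now attach to each `a` in `A` a monomial `m_a` in a lexicographic Hahn field, infinitely larger than
the earlier ones. Lexicographic powers with countable value sets inherit the absence of monotone
`ω₁`-sequences (`IsShortOrder.of_lexLT`), applied once to the exponents and once to the series. The
subfield generated by the monomials has size `ℵ₁`. The disjoint intervals `(m_a, 2 m_a)` refute
c.c.c., and the tree is copied along `a ↦ m_a`. -/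

open Set

/-! ### Orders of type `ω₁` -/

/-- A linear order is `ω₁`-like if it is an uncountable well-order all of whose proper initial
segments are countable. -/
class OmegaOneLike (Ω : Type*) [LinearOrder Ω] : Prop extends WellFoundedLT Ω where
  not_countable : ¬ (univ : Set Ω).Countable
  countable_Iio : ∀ x : Ω, (Iio x).Countable

namespace OmegaOneLike

variable {Ω : Type*} [LinearOrder Ω] [OmegaOneLike Ω]

theorem countable_Iic (x : Ω) : (Iic x).Countable := by
  rw [← Iio_insert]
  exact (countable_Iio x).insert x

theorem exists_forall_lt {C : Set Ω} (hC : C.Countable) : ∃ x, ∀ c ∈ C, c < x := by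
  by_contra! h
  refine not_countable (Ω := Ω) ((hC.biUnion fun c _ => countable_Iic c).mono fun x _ => ?_)
  obtain ⟨c, hc, hx⟩ := h x
  exact mem_biUnion hc hx

theorem exists_le_of_not_countable {C : Set Ω} (hC : ¬ C.Countable) (x : Ω) : ∃ c ∈ C, x ≤ c := by
  by_contra! h
  exact hC ((countable_Iio x).mono fun c hc => h c hc)

/-- A monotone map with countable range is eventually constant. -/
theorem eventually_const {Γ : Type*} [PartialOrder Γ] {D : Ω → Γ} (hD : Monotone D)
    (hc : (range D).Countable) : ∃ x₀, ∀ x, x₀ ≤ x → D x = D x₀ := by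
  by_contra! h
  choose y hy hne using h
  -- Choose one point per value and go beyond all the later points where these values change; the
  -- value found there can no longer change.
  choose s hs using fun v : range D => v.2
  have : Countable (range D) := hc
  obtain ⟨x, hx⟩ := exists_forall_lt (countable_range fun v : range D => y (s v))
  let v : range D := ⟨D x, x, rfl⟩
  have h1 : D (s v) ≤ D (y (s v)) := hD (hy _)
  have h2 : D (y (s v)) ≤ D x := hD (hx _ ⟨v, rfl⟩).le
  exact hne (s v) (le_antisymm (h2.trans_eq (hs v).symm) h1)

end OmegaOneLike

theorem Monotone.range_isWF {Ω Γ : Type*} [LinearOrder Ω] [WellFoundedLT Ω] [LinearOrder Γ]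
    {D : Ω → Γ} (hD : Monotone D) : (range D).IsWF := by
  rw [← image_univ]
  exact ((IsPWO.of_linearOrder univ).image_of_monotone hD).isWF

/-! ### Short orders and lexicographic sequences -/

/-- Every well-ordered subset is countable. -/
def NoUncountableWO (L : Type*) [LinearOrder L] : Prop :=
  ∀ s : Set L, s.IsWF → s.Countable

/-- Every subset which is well-ordered by `<` or by `>` is countable. -/
def IsShortOrder (L : Type*) [LinearOrder L] : Prop :=
  NoUncountableWO L ∧ NoUncountableWO Lᵒᵈ

/-- Cut at the least element with uncountably many predecessors, if there is one. -/
theorem exists_omegaOneLike_subset {L : Type*} [LinearOrder L] {s : Set L} (hs : s.IsWF)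
    (hu : ¬ s.Countable) : ∃ t ⊆ s, OmegaOneLike t := by
  have key : ∀ t ⊆ s, ¬ t.Countable → (∀ x ∈ t, (t ∩ Iio x).Countable) → OmegaOneLike t := by
    intro t hts htu hti
    have hwf : WellFoundedLT t := ⟨(hs.mono hts : t.IsWF)⟩
    refine ⟨?_, fun x => ?_⟩
    · rwa [countable_univ_iff, countable_coe_iff]
    · refine MapsTo.countable_of_injOn (f := Subtype.val) (t := t ∩ Iio x.1) ?_
        Subtype.val_injective.injOn (hti x x.2)
      exact fun y hy => ⟨y.2, hy⟩
  by_cases h : ∃ x ∈ s, ¬ (s ∩ Iio x).Countable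
  · let B := {x ∈ s | ¬ (s ∩ Iio x).Countable}
    have hB : B.IsWF := hs.mono (sep_subset _ _)
    have hne : B.Nonempty := h
    set m := hB.min hne
    have hm : m ∈ B := hB.min_mem hne
    refine ⟨s ∩ Iio m, inter_subset_left, key _ inter_subset_left hm.2 fun x hx => ?_⟩
    by_contra hx'
    refine hB.not_lt_min hne (a := x) ⟨hx.1, fun hc => hx' (hc.mono ?_)⟩ hx.2
    exact fun y hy => ⟨hy.1.1, hy.2⟩
  · push Not at h
    exact ⟨s, subset_rfl, key s subset_rfl hu h⟩

/-- The relation "`f` and `g` have a least difference point, where `f` is below `g`". -/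
def LexLT {Γ V : Type*} [LT Γ] [LT V] (f g : Γ → V) : Prop :=
  ∃ d, (∀ γ < d, f γ = g γ) ∧ f d < g d

/-- A lexicographically increasing sequence of length `ω₁` with countable value set has
uncountably many difference points, and stabilizes below each of them. -/
theorem exists_difference_points {Ω Γ V : Type*} [LinearOrder Ω] [OmegaOneLike Ω] [LinearOrder Γ]
    [LinearOrder V] [Countable V] (hΓ : NoUncountableWO Γᵒᵈ) (f : Ω → Γ → V)
    (hf : ∀ x y, x < y → LexLT (f x) (f y)) :
    ∃ D : Ω → Γ, Monotone D ∧ ¬ (range D).Countable ∧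
      ∀ x, ∃ y₀, ∀ y, y₀ ≤ y → (∀ γ < D x, f x γ = f y γ) ∧ f x (D x) < f y (D x) := by
  choose d hd hlt using hf
  -- Monotonicity in each variable: `d x z` is at most both `d x y` and `d y z`.
  have dle : ∀ x y z (hxy : x < y) (hyz : y < z),
      d x z (hxy.trans hyz) ≤ d x y hxy ∧ d x z (hxy.trans hyz) ≤ d y z hyz := by
    intro x y z hxy hyz
    constructor
    · by_contra! h
      have h1 := hd x z (hxy.trans hyz) _ h
      have h2 := hlt x y hxy
      rcases lt_trichotomy (d x y hxy) (d y z hyz) with h3 | h3 | h3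
      · rw [hd y z hyz _ h3, h1] at h2
        exact lt_irrefl _ h2
      · have h4 := hlt y z hyz
        rw [← h3] at h4
        rw [h1] at h2
        exact lt_asymm h2 h4
      · have h4 := hlt y z hyz
        rw [← hd x y hxy _ h3, hd x z (hxy.trans hyz) _ (h3.trans h)] at h4
        exact lt_irrefl _ h4
    · by_contra! h
      have h1 := hd x z (hxy.trans hyz) _ h
      have h2 := hlt y z hyz
      rcases lt_trichotomy (d y z hyz) (d x y hxy) with h3 | h3 | h3
      · rw [← hd x y hxy _ h3, h1] at h2
        exact lt_irrefl _ h2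
      · have h4 := hlt x y hxy
        rw [← h3] at h4
        rw [h1] at h4
        exact lt_asymm h2 h4
      · have h4 := hlt x y hxy
        rw [hd y z hyz _ h3, hd x z (hxy.trans hyz) _ (h3.trans h)] at h4
        exact lt_irrefl _ h4
  have hsucc : ∀ x : Ω, ∃ y, x < y := fun x => by
    obtain ⟨y, hy⟩ := OmegaOneLike.exists_forall_lt (countable_singleton x)
    exact ⟨y, hy x rfl⟩
  choose σ hσ using hsucc
  -- for fixed `x`, the difference points `d x y` are weakly decreasing in `y`
  have hconst : ∀ x, ∃ δ y₀, x < y₀ ∧ ∀ y (h : x < y), y₀ ≤ y → d x y h = δ := by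
    intro x
    let g : Ω → Γᵒᵈ := fun y =>
      OrderDual.toDual (d x (max y (σ x)) ((hσ x).trans_le (le_max_right _ _)))
    have hg : Monotone g := by
      intro y z hyz
      rcases (max_le_max_right (σ x) hyz).eq_or_lt with h | h
      · exact le_of_eq (by simp only [g, h])
      · exact (dle x _ _ ((hσ x).trans_le (le_max_right _ _)) h).1
    obtain ⟨y₁, hy₁⟩ := OmegaOneLike.eventually_const hg (hΓ _ hg.range_isWF)
    refine ⟨OrderDual.ofDual (g y₁), max y₁ (σ x), (hσ x).trans_le (le_max_right _ _), ?_⟩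
    intro y h hy
    rw [← hy₁ y ((le_max_left _ _).trans hy)]
    simp only [g, OrderDual.ofDual_toDual, max_eq_left ((le_max_right _ _).trans hy)]
  choose D y₀ hxy₀ hD using hconst
  have hev : ∀ x y, y₀ x ≤ y → (∀ γ < D x, f x γ = f y γ) ∧ f x (D x) < f y (D x) := by
    intro x y hy
    have hxy := (hxy₀ x).trans_le hy
    rw [← hD x y hxy hy]
    exact ⟨hd x y hxy, hlt x y hxy⟩
  have hmono : Monotone D := by
    intro x y hxy
    rcases hxy.eq_or_lt with rfl | hxy
    · exact le_rfl
    let z := max (y₀ x) (y₀ y)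
    have hyz : y < z := (hxy₀ y).trans_le (le_max_right _ _)
    rw [← hD x z (hxy.trans hyz) (le_max_left _ _), ← hD y z hyz (le_max_right _ _)]
    exact (dle x y z hxy hyz).2
  refine ⟨D, hmono, fun hc => ?_, fun x => ⟨y₀ x, hev x⟩⟩
  obtain ⟨x₀, hx₀⟩ := OmegaOneLike.eventually_const hmono hc
  -- If `D` is eventually constant, the coordinate there keeps increasing, so it leaves each of the
  -- countably many values for good.
  have hlate : ∀ v : V, ∃ z, ∀ x, z ≤ x → f x (D x₀) ≠ v := by
    intro v
    by_cases h : ∃ x, x₀ ≤ x ∧ f x (D x₀) = v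
    · obtain ⟨x, hx, rfl⟩ := h
      refine ⟨y₀ x, fun y hy => ?_⟩
      have := (hev x y hy).2
      rw [hx₀ x hx] at this
      exact this.ne'
    · exact ⟨x₀, fun x hx hv => h ⟨x, hx, hv⟩⟩
  choose z hz using hlate
  obtain ⟨x, hx⟩ := OmegaOneLike.exists_forall_lt (countable_range z)
  exact hz (f x (D x₀)) x (hx _ ⟨_, rfl⟩).le rfl

theorem NoUncountableWO.of_lexLT {L Γ V : Type*} [LinearOrder L] [LinearOrder Γ] [LinearOrder V]
    [Countable V] (hΓ : IsShortOrder Γ) (φ : L → Γ → V) (hφ : ∀ x y, x < y → LexLT (φ x) (φ y)) :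
    NoUncountableWO L := by
  intro s hs
  by_contra hu
  obtain ⟨t, -, ht⟩ := exists_omegaOneLike_subset hs hu
  obtain ⟨D, hD, hDu, -⟩ := exists_difference_points hΓ.2 (fun x : t => φ x)
    fun x y hxy => hφ _ _ hxy
  exact hDu (hΓ.1 _ hD.range_isWF)

/-- Lexicographic function spaces over short orders with countable value sets are short. -/
theorem IsShortOrder.of_lexLT {L Γ V : Type*} [LinearOrder L] [LinearOrder Γ] [LinearOrder V]
    [Countable V] (hΓ : IsShortOrder Γ) (φ : L → Γ → V) (hφ : ∀ x y, x < y → LexLT (φ x) (φ y)) :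
    IsShortOrder L := by
  have : Countable Vᵒᵈ := ‹Countable V›
  refine ⟨.of_lexLT hΓ φ hφ, .of_lexLT (V := Vᵒᵈ) hΓ
    (fun x γ => OrderDual.toDual (φ (OrderDual.ofDual x) γ)) fun x y hxy => ?_⟩
  obtain ⟨d, h, hlt⟩ := hφ (OrderDual.ofDual y) (OrderDual.ofDual x) hxy
  exact ⟨d, fun γ hγ => congrArg OrderDual.toDual (h γ hγ).symm, hlt⟩

theorem IsShortOrder.not_strictMono {L Ω : Type*} [LinearOrder L] [LinearOrder Ω] [WellFoundedLT Ω]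
    (hL : IsShortOrder L) (hΩ : Uncountable Ω) : ¬ ∃ f : Ω → L, StrictMono f := by
  rintro ⟨f, hf⟩
  have h := hL.1 _ hf.monotone.range_isWF
  rw [← image_univ] at h
  have := countable_of_injective_of_countable_image hf.injective.injOn h
  exact not_countable_iff.mpr hΩ (countable_univ_iff.mp this)

theorem IsShortOrder.not_strictAnti {L Ω : Type*} [LinearOrder L] [LinearOrder Ω] [WellFoundedLT Ω]
    (hL : IsShortOrder L) (hΩ : Uncountable Ω) : ¬ ∃ f : Ω → L, StrictAnti f := by
  rintro ⟨f, hf⟩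
  have hd : IsShortOrder Lᵒᵈ := ⟨hL.2, hL.1⟩
  exact hd.not_strictMono hΩ ⟨_, hf.dual_right⟩

/-! ### Coherent sequences and their tree -/

section Coherent

variable {W : Type*} [LinearOrder W] [OmegaOneLike W]

/-- A coherent sequence of functions `E α : W → ℕ` with support `Iio α`, each of which is
finite-to-one on its support. -/
structure IsCoherentSeq (E : W → W → ℕ) : Prop where
  ne_zero_iff : ∀ α ξ, E α ξ ≠ 0 ↔ ξ < α
  finite_fiber : ∀ α k, k ≠ 0 → {ξ | E α ξ = k}.Finite
  finite_ne : ∀ α β, {ξ | ξ < α ∧ ξ < β ∧ E α ξ ≠ E β ξ}.Finite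

variable (W) in
theorem exists_rank : ∃ r : W → W → ℕ, ∀ α, InjOn (r α) (Iio α) := by
  have : ∀ α : W, ∃ r : W → ℕ, InjOn r (Iio α) := fun α =>
    (countable_iff_exists_injOn).mp (OmegaOneLike.countable_Iio α)
  choose r hr using this
  exact ⟨r, hr⟩

-- A variant of the maximal weight of a walk on ordinals: from `α` one steps down towards `ξ` to the
-- point of `[ξ, α)` of least rank, and `e` records the largest rank met. Values with `α ≤ ξ` are
-- unconstrained.
variable (W) in
theorem exists_pre_coherent : ∃ (r : W → W → ℕ) (b e : W → W → _),
    (∀ α, InjOn (r α) (Iio α)) ∧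
    (∀ α ξ, ξ < α → ξ ≤ b α ξ ∧ b α ξ < α ∧ ∀ β, ξ ≤ β → β < α → r α (b α ξ) ≤ r α β) ∧
    (∀ α ξ, ξ < α → e α ξ = max (e (b α ξ) ξ) (r α (b α ξ))) := by
  obtain ⟨r, hr⟩ := exists_rank W
  have hb : ∀ α ξ : W, ∃ b, ξ < α →
      ξ ≤ b ∧ b < α ∧ ∀ β, ξ ≤ β → β < α → r α b ≤ r α β := by
    intro α ξ
    by_cases h : ξ < α
    · obtain ⟨b, hb, hmin⟩ := exists_minimalFor_of_wellFoundedLT (fun β => ξ ≤ β ∧ β < α) (r α)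
        ⟨ξ, le_rfl, h⟩
      exact ⟨b, fun _ => ⟨hb.1, hb.2, fun β h1 h2 =>
        (le_total _ _).elim id fun h3 => hmin ⟨h1, h2⟩ h3⟩⟩
    · exact ⟨ξ, fun h' => absurd h' h⟩
  choose b hb using hb
  classical
  let F : (α : W) → ((β : W) → β < α → W → ℕ) → W → ℕ := fun α IH ξ =>
    if h : b α ξ < α then max (IH (b α ξ) h ξ) (r α (b α ξ)) else 0
  refine ⟨r, b, (wellFounded_lt (α := W)).fix F, hr, hb, fun α ξ h => ?_⟩
  rw [WellFounded.fix_eq]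
  simp only [F, dif_pos (hb α ξ h).2.1]

variable (W) in
theorem exists_isCoherentSeq : ∃ E : W → W → ℕ, IsCoherentSeq E := by
  obtain ⟨r, b, e, hr, hb, he⟩ := exists_pre_coherent W
  have hfin : ∀ α k, {β | β < α ∧ r α β ≤ k}.Finite := by
    intro α k
    refine Finite.of_finite_image (f := r α) ((finite_Iic k).subset ?_)
      ((hr α).mono fun β h => h.1)
    rintro _ ⟨β, h, rfl⟩
    exact h.2
  -- A bound on `e α ξ` leaves finitely many first steps. The case `ξ = α` is included because a
  -- step may land on `ξ` itself.
  have hP : ∀ α k, {ξ | ξ ≤ α ∧ e α ξ ≤ k}.Finite := by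
    intro α
    induction α using WellFoundedLT.induction with
    | _ α ih =>
    intro k
    refine ((finite_singleton α).union ((hfin α k).biUnion fun β hβ => ih β hβ.1 k)).subset ?_
    rintro ξ ⟨hξ, hk⟩
    rcases hξ.eq_or_lt with rfl | hξ
    · exact Or.inl rfl
    obtain ⟨h1, h2, -⟩ := hb α ξ hξ
    rw [he α ξ hξ, max_le_iff] at hk
    exact Or.inr (mem_biUnion (x := b α ξ) ⟨h2, hk.2⟩ ⟨h1, hk.1⟩)
  -- For `ξ ≤ β` the first step from `α` has rank at most that of `β`, so only finitely many `γ`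
  -- occur. For each, either `e γ ξ` is small, hence `ξ` is one of finitely many, or `e α ξ = e γ ξ`
  -- and induction compares `γ` with `β`.
  have hQ : ∀ α, ∀ β < α, {ξ | ξ ≤ β ∧ e α ξ ≠ e β ξ}.Finite := by
    intro α
    induction α using WellFoundedLT.induction with
    | _ α ih =>
    intro β hβ
    have hcmp : ∀ γ < α, {ξ | ξ ≤ γ ∧ ξ ≤ β ∧ e γ ξ ≠ e β ξ}.Finite := by
      intro γ hγ
      rcases lt_trichotomy γ β with h | rfl | h
      · exact (ih β hβ γ h).subset fun ξ hξ => ⟨hξ.1, hξ.2.2.symm⟩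
      · simp
      · exact (ih γ hγ β h).subset fun ξ hξ => hξ.2
    refine ((hfin α (r α β)).biUnion fun γ hγ =>
      (hP γ (r α γ)).union (hcmp γ hγ.1)).subset ?_
    rintro ξ ⟨hξ, hne⟩
    obtain ⟨h1, h2, h3⟩ := hb α ξ (hξ.trans_lt hβ)
    refine mem_biUnion (x := b α ξ) ⟨h2, h3 β hξ hβ⟩ ?_
    rw [he α ξ (hξ.trans_lt hβ)] at hne
    by_cases h : e (b α ξ) ξ ≤ r α (b α ξ)
    · exact Or.inl ⟨h1, h⟩
    · rw [max_eq_left (not_le.mp h).le] at hne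
      exact Or.inr ⟨h1, hξ, hne⟩
  classical
  -- The shift by one reserves the value zero for points outside the support.
  refine ⟨fun α ξ => if ξ < α then e α ξ + 1 else 0, ⟨fun α ξ => by simp, fun α k hk => ?_, ?_⟩⟩
  · refine (hP α k).subset fun ξ hξ => ?_
    simp only [mem_ofPred_eq] at hξ
    split_ifs at hξ with h
    · exact ⟨h.le, by omega⟩
    · exact absurd hξ.symm hk
  · intro α β
    have key : ∀ α β, β < α → {ξ | ξ < β ∧ e α ξ ≠ e β ξ}.Finite := fun α β h =>
      (hQ α β h).subset fun ξ hξ => ⟨hξ.1.le, hξ.2⟩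
    rcases lt_trichotomy α β with h | rfl | h
    · refine (key β α h).subset fun ξ ⟨h1, h2, h3⟩ => ⟨h1, fun h4 => h3 ?_⟩
      simp only [if_pos h1, if_pos h2, h4]
    · simp
    · refine (key α β h).subset fun ξ ⟨h1, h2, h3⟩ => ⟨h2, fun h4 => h3 ?_⟩
      simp only [if_pos h1, if_pos h2, h4]

/-- The finite modifications of `E α` with the same support. -/
def modifications (E : W → W → ℕ) (α : W) : Set (W → ℕ) :=
  {h | (∀ ξ, h ξ ≠ 0 ↔ ξ < α) ∧ {ξ | h ξ ≠ E α ξ}.Finite}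

/-- The coherent tree generated by `E`: all finite modifications of all `E α`. -/
def coherentTree (E : W → W → ℕ) : Set (W → ℕ) := {h | ∃ α, h ∈ modifications E α}

open Classical in
/-- The function which agrees with `g` below `α`, has value `v` at `α`, and vanishes above. -/
noncomputable def node (g : W → ℕ) (α : W) (v : ℕ) : W → ℕ := fun ξ =>
  if ξ < α then g ξ else if ξ = α then v else 0

omit [OmegaOneLike W] in
theorem node_of_lt {g : W → ℕ} {α ξ : W} {v : ℕ} (h : ξ < α) : node g α v ξ = g ξ := if_pos h

omit [OmegaOneLike W] in
@[simp] theorem node_self {g : W → ℕ} {α : W} {v : ℕ} : node g α v α = v := by simp [node]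

omit [OmegaOneLike W] in
theorem node_of_gt {g : W → ℕ} {α ξ : W} {v : ℕ} (h : α < ξ) : node g α v ξ = 0 := by
  simp [node, h.not_gt, h.ne']

variable {E : W → W → ℕ} (hE : IsCoherentSeq E)
include hE

omit [OmegaOneLike W] in
theorem IsCoherentSeq.mem_modifications (α : W) : E α ∈ modifications E α :=
  ⟨hE.ne_zero_iff α, by simp⟩

/-- A modification is coded by the finite part of its graph that differs from `E α`. -/
theorem IsCoherentSeq.countable_modifications (α : W) : (modifications E α).Countable := by
  have hc : (Iio α ×ˢ (univ : Set ℕ)).Countable :=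
    (OmegaOneLike.countable_Iio α).prod countable_univ
  refine MapsTo.countable_of_injOn (f := fun h => {p : W × ℕ | p.2 = h p.1 ∧ h p.1 ≠ E α p.1})
    (t := {t | t.Finite ∧ t ⊆ Iio α ×ˢ (univ : Set ℕ)}) ?_ ?_ (countable_ofPred_finite_subset hc)
  · rintro h ⟨h1, h2⟩
    constructor
    · refine (h2.image fun ξ => (ξ, h ξ)).subset ?_
      rintro ⟨ξ, n⟩ ⟨hn, hne⟩
      exact ⟨ξ, hne, Prod.ext rfl hn.symm⟩
    · rintro ⟨ξ, n⟩ ⟨-, hne⟩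
      refine ⟨?_, mem_univ _⟩
      by_contra hξ
      have e1 : h ξ = 0 := by_contra fun h0 => hξ ((h1 ξ).mp h0)
      have e2 : E α ξ = 0 := by_contra fun h0 => hξ ((hE.ne_zero_iff α ξ).mp h0)
      exact hne (e1.trans e2.symm)
  · intro h _ h' _ heq
    have key : ∀ ξ n, (n = h ξ ∧ h ξ ≠ E α ξ) ↔ (n = h' ξ ∧ h' ξ ≠ E α ξ) := fun ξ n =>
      Set.ext_iff.mp heq (ξ, n)
    funext ξ
    by_cases h1 : h ξ = E α ξ
    · by_contra h2
      exact h2 ((key ξ (h' ξ)).mpr ⟨rfl, fun h3 => h2 (h1.trans h3.symm)⟩).1.symm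
    · exact ((key ξ (h ξ)).mp ⟨rfl, h1⟩).1

omit [OmegaOneLike W] in
theorem IsCoherentSeq.finite_fiber_of_mem {h : W → ℕ} (hh : h ∈ coherentTree E) {k : ℕ}
    (hk : k ≠ 0) : {ξ | h ξ = k}.Finite := by
  obtain ⟨α, -, h2⟩ := hh
  refine (h2.union (hE.finite_fiber α k hk)).subset fun ξ hξ => ?_
  by_cases h3 : h ξ = E α ξ
  · exact Or.inr (h3.symm.trans hξ)
  · exact Or.inl h3

omit [OmegaOneLike W] hE in
theorem ne_zero_of_le {h : W → ℕ} (hh : h ∈ coherentTree E) {α β : W} (hβ : h β ≠ 0)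
    (hαβ : α ≤ β) : h α ≠ 0 := by
  obtain ⟨γ, h1, -⟩ := hh
  exact (h1 α).mpr (hαβ.trans_lt ((h1 β).mp hβ))

omit [OmegaOneLike W] in
theorem IsCoherentSeq.node_mem {g : W → ℕ} (hg : g ∈ coherentTree E) {α α' : W} (hα : g α ≠ 0)
    (hα' : ∀ ξ, ξ < α' ↔ ξ ≤ α) {v : ℕ} (hv : v ≠ 0) : node g α v ∈ modifications E α' := by
  obtain ⟨β, h1, h2⟩ := hg
  have hαβ := (h1 α).mp hα
  constructor
  · intro ξ
    rw [hα']
    rcases lt_trichotomy ξ α with h | rfl | h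
    · rw [node_of_lt h]
      simp [h.le, (h1 ξ).mpr (h.trans hαβ)]
    · simpa using hv
    · simp [node_of_gt h, h]
  · refine ((finite_singleton α).union (h2.union (hE.finite_ne β α'))).subset fun ξ hξ => ?_
    rcases lt_trichotomy ξ α with h | rfl | h
    · simp only [mem_ofPred_eq, node_of_lt h] at hξ
      by_cases h3 : g ξ = E β ξ
      · exact Or.inr (Or.inr ⟨h.trans hαβ, (hα' ξ).mpr h.le, h3 ▸ hξ⟩)
      · exact Or.inr (Or.inl h3)
    · exact Or.inl rfl
    · simp only [mem_ofPred_eq, node_of_gt h] at hξ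
      exact absurd ((hα' ξ).mp ((hE.ne_zero_iff α' ξ).mp hξ.symm)) h.not_ge

/-- The coherent tree has no cofinal branch. -/
theorem IsCoherentSeq.no_branch (G : W → ℕ) :
    ¬ ∀ δ, ∃ h ∈ coherentTree E, ∀ γ < δ, h γ = G γ ∧ h γ ≠ 0 := by
  intro H
  -- Some value repeats infinitely often along `G`, already below a countable bound `δ`; a tree
  -- element agreeing with `G` up to there is not finite-to-one.
  have hinf : ∃ k, {ξ | G ξ = k}.Infinite := by
    by_contra! hfin
    refine OmegaOneLike.not_countable (Ω := W)
      ((countable_iUnion fun k => (hfin k).countable).mono fun ξ _ => ?_)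
    exact mem_iUnion.mpr ⟨G ξ, rfl⟩
  obtain ⟨k, hk⟩ := hinf
  have hc : (range fun n => (hk.natEmbedding _ n : W)).Countable := countable_range _
  obtain ⟨δ, hδ⟩ := OmegaOneLike.exists_forall_lt hc
  obtain ⟨h, hh, hG⟩ := H δ
  have hG' : ∀ n, h (hk.natEmbedding _ n) = k ∧ k ≠ 0 := fun n => by
    have h1 := hG _ (hδ _ ⟨n, rfl⟩)
    have h2 : G (hk.natEmbedding _ n) = k := (hk.natEmbedding _ n).2
    exact ⟨h1.1.trans h2, by rw [← h2, ← h1.1]; exact h1.2⟩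
  refine (infinite_range_of_injective (f := fun n => (hk.natEmbedding _ n : W)) ?_)
    ((hE.finite_fiber_of_mem hh (hG' 0).2).subset ?_)
  · exact Subtype.val_injective.comp (hk.natEmbedding _).injective
  · rintro _ ⟨n, rfl⟩
    exact (hG' n).1

/-- The difference points of an uncountable increasing sequence are cofinal in `W`, so its members
stabilize to a cofinal branch. The coding `c` allows `V` to be `ℕ` with either order. -/
theorem IsCoherentSeq.noUncountableWO {L V : Type*} [LinearOrder L] [LinearOrder V] [Countable V]
    (φ : L → W → V) (hφ : ∀ x y, x < y → LexLT (φ x) (φ y)) (c : V → ℕ) (hci : c.Injective)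
    (hc : ∀ x, (fun ξ => c (φ x ξ)) ∈ coherentTree E) :
    NoUncountableWO L := by
  intro s hs
  by_contra hu
  obtain ⟨t, -, ht⟩ := exists_omegaOneLike_subset hs hu
  have hW : NoUncountableWO Wᵒᵈ := by
    intro u hu
    rcases u.eq_empty_or_nonempty with rfl | hne
    · exact countable_empty
    · exact (OmegaOneLike.countable_Iic (OrderDual.ofDual (hu.min hne))).mono
        fun x hx => hu.min_le hne hx
  obtain ⟨D, hD, hDu, hst⟩ := exists_difference_points hW (fun x : t => φ x)
    fun x y hxy => hφ _ _ hxy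
  have hcof : ∀ γ, ∃ x, γ ≤ D x := fun γ => by
    obtain ⟨_, ⟨x, rfl⟩, hx⟩ := OmegaOneLike.exists_le_of_not_countable hDu γ
    exact ⟨x, hx⟩
  have hcof' : ∀ γ, ∃ x, γ < D x := fun γ => by
    obtain ⟨δ, hδ⟩ := OmegaOneLike.exists_forall_lt (countable_singleton γ)
    obtain ⟨x, hx⟩ := hcof δ
    exact ⟨x, (hδ γ rfl).trans_le hx⟩
  choose X hX using hcof'
  refine hE.no_branch (fun γ => c (φ (X γ) γ)) fun δ => ?_
  obtain ⟨x, hx⟩ := hcof δ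
  obtain ⟨y₀, hy₀⟩ := hst x
  have hagree : ∀ y, y₀ ≤ y → ∀ γ < δ, c (φ y γ) = c (φ (X γ) γ) := by
    intro y hy γ hγ
    obtain ⟨z₀, hz₀⟩ := hst (X γ)
    let z := max y z₀
    rw [← (hy₀ y hy).1 γ (hγ.trans_le hx),
      (hy₀ z (hy.trans (le_max_left _ _))).1 γ (hγ.trans_le hx),
      (hz₀ z (le_max_right _ _)).1 γ (hX γ)]
  have hxagree : ∀ γ < δ, c (φ x γ) = c (φ (X γ) γ) := by
    intro γ hγ
    rw [(hy₀ y₀ le_rfl).1 γ (hγ.trans_le hx)]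
    exact hagree y₀ le_rfl γ hγ
  -- Two functions that differ at `D x` cannot both vanish there; a nonzero one has support reaching
  -- past `δ`.
  by_cases h0 : c (φ x (D x)) = 0
  · have h1 : c (φ y₀ (D x)) ≠ 0 := fun h1 =>
      (hy₀ y₀ le_rfl).2.ne (hci (h0.trans h1.symm))
    exact ⟨_, hc y₀, fun γ hγ => ⟨hagree y₀ le_rfl γ hγ,
      ne_zero_of_le (hc y₀) h1 (hγ.le.trans hx)⟩⟩
  · exact ⟨_, hc x, fun γ hγ => ⟨hxagree γ hγ, ne_zero_of_le (hc x) h0 (hγ.le.trans hx)⟩⟩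

end Coherent

/-! ### Trees of restrictions and lexicographic intervals -/

section Tree

/-- A criterion for being an Aronszajn tree: every node `x` has a height `ℓ x` in an `ω₁`-like
order and a label `g x`, and `x ≤ y` means that the label of `y` extends that of `x`. -/
theorem isAronszajnTree_of_labels {P W : Type} [PartialOrder P] [LinearOrder W] [OmegaOneLike W]
    (hW : Ordinal.type (fun a b : W => a < b) = Ordinal.omega 1) (ℓ : P → W) (g : P → W → ℕ)
    (hle : ∀ x y, x ≤ y ↔ ℓ x ≤ ℓ y ∧ ∀ ξ ≤ ℓ x, g x ξ = g y ξ)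
    (hres : ∀ y, ∀ α ≤ ℓ y, ∃ x ≤ y, ℓ x = α)
    (hcount : ∀ α, {x | ℓ x = α}.Countable) (hne : ∀ α, ∃ x, ℓ x = α)
    (hbranch : ∀ G : W → ℕ, ¬ ∀ δ, ∃ x, δ ≤ ℓ x ∧ ∀ γ ≤ δ, g x γ = G γ) :
    IsAronszajnTree P := by
  have hcomp : ∀ x y z, x ≤ z → y ≤ z → ℓ x ≤ ℓ y → x ≤ y := by
    intro x y z hx hy h
    rw [hle] at hx hy ⊢
    exact ⟨h, fun ξ hξ => (hx.2 ξ hξ).trans (hy.2 ξ (hξ.trans h)).symm⟩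
  have hinj : ∀ x y, x ≤ y → ℓ x = ℓ y → x = y := by
    intro x y hxy h
    exact le_antisymm hxy (hcomp y x y le_rfl hxy h.ge)
  have hlt : ∀ x y, x < y → ℓ x < ℓ y := fun x y h =>
    lt_of_le_of_ne ((hle x y).mp h.le).1 fun h' => h.ne (hinj x y h.le h')
  have hltz : ∀ x y z, x ≤ z → y ≤ z → (ℓ x < ℓ y ↔ x < y) := fun x y z hx hy =>
    ⟨fun h => lt_of_le_of_ne (hcomp x y z hx hy h.le) fun h' => h.ne (congrArg ℓ h'), hlt x y⟩
  have iso : ∀ y, Nonempty ((fun a b : Iio y => a < b) ≃r (fun a b : Iio (ℓ y) => a < b)) := by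
    intro y
    let f : Iio y → Iio (ℓ y) := fun x => ⟨ℓ x, hlt _ _ x.2⟩
    have hf : f.Bijective := by
      constructor
      · rintro ⟨x, hx⟩ ⟨x', hx'⟩ h
        have h' : ℓ x = ℓ x' := congrArg Subtype.val h
        exact Subtype.ext (hinj x x' (hcomp x x' y hx.le hx'.le h'.le) h')
      · rintro ⟨α, hα⟩
        obtain ⟨x, hx, rfl⟩ := hres y α (mem_Iio.mp hα).le
        exact ⟨⟨x, lt_of_le_of_ne hx fun h => (mem_Iio.mp hα).ne (congrArg ℓ h)⟩, rfl⟩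
    exact ⟨⟨Equiv.ofBijective f hf, fun {a b} => hltz a b y (le_of_lt a.2) (le_of_lt b.2)⟩⟩
  have htree : IsTreeOrder P := ⟨fun y => (iso y).some.toRelEmbedding.isWellOrder⟩
  have hheight : ∀ y, nodeHeight y = Ordinal.typein (fun a b : W => a < b) (ℓ y) := fun y =>
    (iso y).some.ordinalType_congr
  have hempty : ∀ α : Ordinal.{0}, treeLevel P α = ∅ ↔ Ordinal.omega 1 ≤ α := by
    intro α
    constructor
    · intro h
      by_contra! hα
      rw [← hW] at hα
      obtain ⟨w, hw⟩ := Ordinal.typein_surj (fun a b : W => a < b) hα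
      obtain ⟨x, rfl⟩ := hne w
      exact (h ▸ (hheight x).trans hw : x ∈ (∅ : Set P))
    · intro h
      refine eq_empty_of_forall_notMem fun x hx => ?_
      have h1 : nodeHeight x = α := hx
      rw [hheight] at h1
      have h2 := Ordinal.typein_lt_type (fun a b : W => a < b) (ℓ x)
      rw [hW, h1] at h2
      exact h.not_gt h2
  refine ⟨htree, ?_, ?_, ?_⟩
  · refine le_antisymm (csInf_le' ((hempty _).mpr le_rfl)) ?_
    exact le_csInf ⟨_, (hempty _).mpr le_rfl⟩ fun α hα => (hempty α).mp hα
  · intro α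
    by_cases h : ∃ x : P, nodeHeight x = α
    · obtain ⟨x, rfl⟩ := h
      refine (hcount (ℓ x)).mono fun y hy => ?_
      have h1 : nodeHeight y = nodeHeight x := hy
      rw [hheight, hheight] at h1
      exact Ordinal.typein_injective _ h1
    · refine (countable_empty).mono fun y hy => h ⟨y, hy⟩
  · intro C hC
    by_contra hu
    have hCinj : InjOn ℓ C := by
      intro x hx y hy h
      rcases hC.total hx hy with h' | h'
      · exact hinj x y h' h
      · exact (hinj y x h' h.symm).symm
    have hCu : ¬ (ℓ '' C).Countable := fun h =>
      hu (countable_of_injective_of_countable_image hCinj h)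
    have hcof : ∀ δ, ∃ x ∈ C, δ ≤ ℓ x := fun δ => by
      obtain ⟨_, ⟨x, hx, rfl⟩, h⟩ := OmegaOneLike.exists_le_of_not_countable hCu δ
      exact ⟨x, hx, h⟩
    choose X hXC hX using hcof
    -- The labels along an uncountable chain glue to a branch.
    refine hbranch (fun γ => g (X γ) γ) fun δ => ⟨X δ, hX δ, fun γ hγ => ?_⟩
    rcases hC.total (hXC δ) (hXC γ) with h | h
    · exact ((hle _ _).mp h).2 γ (hγ.trans (hX δ))
    · exact (((hle _ _).mp h).2 γ (hX γ)).symm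

variable {W : Type*} [LinearOrder W] [WellFoundedLT W]

/-- The set of functions which agree with `g` up to and including `α` is a half-open interval. -/
theorem mem_Ico_node_iff {g h : W → ℕ} {α : W} :
    toLex h ∈ Ico (toLex (node g α (g α))) (toLex (node g α (g α + 1))) ↔
      ∀ ξ ≤ α, h ξ = g ξ := by
  rw [mem_Ico, ← not_lt]
  change ¬ LexLT h (node g α (g α)) ∧ LexLT h (node g α (g α + 1)) ↔ _
  constructor
  · rintro ⟨h1, d, hd, hlt⟩
    rcases lt_trichotomy d α with h2 | rfl | h2
    · refine absurd ⟨d, fun γ hγ => ?_, ?_⟩ h1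
      · rw [hd γ hγ, node_of_lt (hγ.trans h2), node_of_lt (hγ.trans h2)]
      · rwa [node_of_lt h2] at hlt ⊢
    · rw [node_self] at hlt
      have hd' : ∀ γ < d, h γ = g γ := fun γ hγ => by rw [hd γ hγ, node_of_lt hγ]
      intro ξ hξ
      rcases hξ.eq_or_lt with rfl | hξ
      · refine le_antisymm (by omega) (not_lt.mp fun h3 => h1 ⟨ξ, fun γ hγ => ?_, ?_⟩)
        · rw [hd' γ hγ, node_of_lt hγ]
        · rwa [node_self]
      · exact hd' ξ hξ
    · rw [node_of_gt h2] at hlt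
      exact absurd hlt (Nat.not_lt_zero _)
  · intro hξ
    constructor
    · rintro ⟨d, hd, hlt⟩
      rcases lt_trichotomy d α with h2 | rfl | h2
      · rw [hξ d h2.le, node_of_lt h2] at hlt
        exact lt_irrefl _ hlt
      · rw [hξ d le_rfl, node_self] at hlt
        exact lt_irrefl _ hlt
      · rw [node_of_gt h2] at hlt
        exact Nat.not_lt_zero _ hlt
    · refine ⟨α, fun γ hγ => ?_, ?_⟩
      · rw [hξ γ hγ.le, node_of_lt hγ]
      · rw [hξ α le_rfl, node_self]
        exact Nat.lt_succ_self _

omit [WellFoundedLT W] in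
theorem node_lt_node {g : W → ℕ} {α : W} :
    toLex (node g α (g α)) < toLex (node g α (g α + 1)) :=
  ⟨α, fun γ hγ => (node_of_lt hγ).trans (node_of_lt hγ).symm, by
    simp only [Pi.toLex_apply, node_self, Nat.lt_succ_self]⟩

end Tree

/-! ### Open intervals of ordered fields -/

section Intervals

variable {k : Type*} [Field k] [LinearOrder k] [IsStrictOrderedRing k]

/-- An ordered field is isomorphic, as an order, to each of its nonempty open intervals. -/
theorem IsOpenInterval.nonempty_orderIso {s : Set k} (hs : IsOpenInterval s) (hne : s.Nonempty) :
    Nonempty (k ≃o s) := by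
  rcases hs with ⟨a, b, rfl⟩ | ⟨a, rfl⟩ | ⟨b, rfl⟩ | rfl
  · have hab : a < b := nonempty_Ioo.mp hne
    have hd : 0 < (b - a) / 2 := half_pos (sub_pos.mpr hab)
    -- The affine map from `(-1, 1)` onto `(a, b)`.
    refine ⟨(orderIsoIooNegOneOne k).trans (StrictMono.orderIsoOfRightInverse
      (fun x => ⟨a + (b - a) / 2 * (1 + x), ?_, ?_⟩) ?_
      (fun y => ⟨(y - a) / ((b - a) / 2) - 1, ?_, ?_⟩) ?_)⟩
    · have h : 0 < 1 + (x : k) := by linarith [x.2.1]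
      have := mul_pos hd h
      linarith
    · have h : 0 < 1 - (x : k) := by linarith [x.2.2]
      have := mul_pos hd h
      linarith
    · intro x y hxy
      have h : (x : k) < y := hxy
      have := mul_lt_mul_of_pos_left h hd
      change a + (b - a) / 2 * (1 + (x : k)) < a + (b - a) / 2 * (1 + (y : k))
      linarith
    · have h : 0 < (y : k) - a := sub_pos.mpr y.2.1
      have := div_pos h hd
      linarith
    · have h : ((y : k) - a) / ((b - a) / 2) < 2 := by
        rw [div_lt_iff₀ hd]
        linarith [y.2.2]
      linarith
    · intro y
      refine Subtype.ext ?_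
      change a + (b - a) / 2 * (1 + (((y : k) - a) / ((b - a) / 2) - 1)) = y
      field_simp [hd.ne', (sub_pos.mpr hab).ne']
      ring
  -- The map `x ↦ a + (1 + x) / (1 - x)`; the next case uses its mirror image.
  · refine ⟨(orderIsoIooNegOneOne k).trans (StrictMono.orderIsoOfRightInverse
      (fun x => ⟨a + (2 / (1 - x) - 1), ?_⟩) ?_ (fun y => ⟨1 - 2 / (y - a + 1), ?_, ?_⟩) ?_)⟩
    · have h : 0 < 1 - (x : k) := by linarith [x.2.2]
      have h2 : 1 < 2 / (1 - (x : k)) := by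
        rw [lt_div_iff₀ h]
        linarith [x.2.1]
      exact mem_Ioi.mpr (by linarith)
    · intro x y hxy
      have h : (x : k) < y := hxy
      have hy : 0 < 1 - (y : k) := by linarith [y.2.2]
      have := div_lt_div_of_pos_left (zero_lt_two (α := k)) hy (by linarith : 1 - (y : k) < 1 - x)
      change a + (2 / (1 - (x : k)) - 1) < a + (2 / (1 - (y : k)) - 1)
      linarith
    · have h : a < (y : k) := y.2
      have h2 : 2 / ((y : k) - a + 1) < 2 := by
        rw [div_lt_iff₀ (by linarith)]
        linarith
      linarith
    · have h : a < (y : k) := y.2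
      have h2 : 0 < 2 / ((y : k) - a + 1) := div_pos zero_lt_two (by linarith)
      linarith
    · intro y
      refine Subtype.ext ?_
      have h : a < (y : k) := y.2
      have h2 : (y : k) - a + 1 ≠ 0 := by linarith
      change a + (2 / (1 - (1 - 2 / ((y : k) - a + 1))) - 1) = y
      rw [sub_sub_cancel, div_div_cancel₀ two_ne_zero]
      ring
  · refine ⟨(orderIsoIooNegOneOne k).trans (StrictMono.orderIsoOfRightInverse
      (fun x => ⟨b - (2 / (1 + x) - 1), ?_⟩) ?_ (fun y => ⟨2 / (b - y + 1) - 1, ?_, ?_⟩) ?_)⟩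
    · have h : 0 < 1 + (x : k) := by linarith [x.2.1]
      have h2 : 1 < 2 / (1 + (x : k)) := by
        rw [lt_div_iff₀ h]
        linarith [x.2.2]
      exact mem_Iio.mpr (by linarith)
    · intro x y hxy
      have h : (x : k) < y := hxy
      have hx : 0 < 1 + (x : k) := by linarith [x.2.1]
      have := div_lt_div_of_pos_left (zero_lt_two (α := k)) hx (by linarith : 1 + (x : k) < 1 + y)
      change b - (2 / (1 + (x : k)) - 1) < b - (2 / (1 + (y : k)) - 1)
      linarith
    · have h : (y : k) < b := y.2
      have h2 : 0 < 2 / (b - (y : k) + 1) := div_pos zero_lt_two (by linarith)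
      linarith
    · have h : (y : k) < b := y.2
      have h2 : 2 / (b - (y : k) + 1) < 2 := by
        rw [div_lt_iff₀ (by linarith)]
        linarith
      linarith
    · intro y
      refine Subtype.ext ?_
      have h : (y : k) < b := y.2
      have h2 : b - (y : k) + 1 ≠ 0 := by linarith
      change b - (2 / (1 + (2 / (b - (y : k) + 1) - 1)) - 1) = y
      rw [add_sub_cancel, div_div_cancel₀ two_ne_zero]
      ring
  · exact ⟨OrderIso.Set.univ.symm⟩

end Intervals

/-! ### The Hahn field and its monomials -/

section Hahn

variable (A : Type) [LinearOrder A]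

/-- The group of finitely supported integer functions, ordered lexicographically. -/
abbrev ExponentGroup : Type := Lex (A →₀ ℤ)

/-- The lexicographically ordered field of Hahn series over `ExponentGroup A`. -/
abbrev HahnLexField : Type := Lex (HahnSeries (ExponentGroup A) ℚ)

variable {A}

/-- The exponent attached to an element of the index order. -/
noncomputable def exponent (a : A) : ExponentGroup A := toLex (Finsupp.single a 1)

/-- The first difference occurs at the smaller index. Smaller exponents dominate in a Hahn series,
so the monomials will increase. -/
theorem exponent_strictAnti : StrictAnti (exponent (A := A)) := by
  intro a b h
  refine Finsupp.Lex.lt_iff.mpr ⟨a, fun d hd => ?_, ?_⟩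
  · simp [exponent, Finsupp.single_eq_of_ne hd.ne, Finsupp.single_eq_of_ne (hd.trans h).ne]
  · simp [exponent, h.ne]

/-- The monomials attached to the elements of the index order. -/
noncomputable def monomialOf (a : A) : HahnLexField A := toLex (HahnSeries.single (exponent a) 1)

theorem single_exponent_lt (q : ℚ) {a b : A} (h : a < b) :
    toLex (HahnSeries.single (exponent a) q) < monomialOf b := by
  refine (HahnSeries.lt_iff _ _).mpr ⟨exponent b, fun γ hγ => ?_, ?_⟩
  · simp [monomialOf, HahnSeries.coeff_single_of_ne hγ.ne,
      HahnSeries.coeff_single_of_ne (hγ.trans (exponent_strictAnti h)).ne]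
  · simp [monomialOf, HahnSeries.coeff_single_of_ne (exponent_strictAnti h).ne]

theorem monomialOf_strictMono : StrictMono (monomialOf (A := A)) := fun _ _ h =>
  single_exponent_lt 1 h

theorem monomialOf_add_lt {a b : A} (h : a < b) : monomialOf a + monomialOf a < monomialOf b := by
  have h1 := single_exponent_lt 2 h
  have h2 : monomialOf a + monomialOf a = toLex (HahnSeries.single (exponent a) (2 : ℚ)) := by
    rw [← one_add_one_eq_two, HahnSeries.single_add]
    rfl
  rwa [h2]

theorem monomialOf_pos (a : A) : 0 < monomialOf a := by
  rw [← HahnSeries.leadingCoeff_pos_iff]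
  simp [monomialOf]

theorem IsShortOrder.exponentGroup (hA : IsShortOrder A) : IsShortOrder (ExponentGroup A) :=
  .of_lexLT hA (fun x a => ofLex x a) fun _ _ h => Finsupp.Lex.lt_iff.mp h

theorem IsShortOrder.hahnLexField (hA : IsShortOrder A) : IsShortOrder (HahnLexField A) :=
  .of_lexLT hA.exponentGroup (fun x γ => (ofLex x).coeff γ) fun _ _ h =>
    (HahnSeries.lt_iff _ _).mp h

theorem IsShortOrder.of_strictMono {L M : Type*} [LinearOrder L] [LinearOrder M]
    (hM : IsShortOrder M) {f : L → M} (hf : StrictMono f) : IsShortOrder L := by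
  have key : ∀ {L M : Type _} [LinearOrder L] [LinearOrder M], NoUncountableWO M → ∀ {f : L → M},
      StrictMono f → NoUncountableWO L := by
    intro L M _ _ hM f hf s hs
    refine countable_of_injective_of_countable_image hf.injective.injOn
      (hM _ (hs.isPWO.image_of_monotone hf.monotone).isWF)
  exact ⟨key hM.1 hf, key hM.2 hf.dual⟩

variable (A) in
/-- The ordered field generated by the monomials. -/
noncomputable abbrev monomialField : Subfield (HahnLexField A) :=
  Subfield.closure (range monomialOf)

/-- The monomials as elements of the field they generate. -/
noncomputable def monomialIn (a : A) : monomialField A :=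
  ⟨monomialOf a, Subfield.subset_closure ⟨a, rfl⟩⟩

theorem monomialIn_strictMono : StrictMono (monomialIn (A := A)) := fun _ _ h =>
  monomialOf_strictMono h

/-- The intervals `(m_a, 2 m_a)` are disjoint because `2 m_a < m_b` for `a < b`. -/
theorem not_isCCCOrder_monomialField (hA : ¬ Countable A) : ¬ IsCCCOrder (monomialField A) := by
  intro h
  have hpos : ∀ a : A, 0 < monomialIn a := fun a => monomialOf_pos a
  have hlt : ∀ {a b : A}, a < b → monomialIn a + monomialIn a < monomialIn b := fun h =>
    monomialOf_add_lt h
  let I : A → Set (monomialField A) := fun a => Ioo (monomialIn a) (monomialIn a + monomialIn a)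
  have hne : ∀ a, (I a).Nonempty := fun a => nonempty_Ioo.mpr (lt_add_of_pos_right _ (hpos a))
  have hdis : ∀ a b, a < b → Disjoint (I a) (I b) := fun a b hab =>
    disjoint_left.mpr fun x hx hx' => lt_asymm (hx.2.trans (hlt hab)) hx'.1
  have hdis' : Pairwise (Function.onFun Disjoint I) := fun a b hab =>
    (lt_or_gt_of_ne hab).elim (hdis a b) fun h => (hdis b a h).symm
  have hinj : I.Injective := fun a b hab => by
    by_contra hne'
    have h1 := hdis' hne'
    rw [Function.onFun, hab, disjoint_self] at h1
    exact (hne b).ne_empty h1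
  have hc := h (range I) (by rintro _ ⟨a, rfl⟩; exact ⟨hne a, Or.inl ⟨_, _, rfl⟩⟩) (by
    rintro _ ⟨a, rfl⟩ _ ⟨b, rfl⟩ hab
    exact hdis' fun h => hab (congrArg I h))
  have : Countable (range I) := hc
  exact hA (rangeFactorization_injective.mpr hinj).countable

end Hahn

/-- Inclusion depends only on the order of the endpoints, so the tree survives passage to a larger
order whose intervals gain new points. -/
theorem StrictMono.Ico_subset_Ico_iff {α β : Type*} [LinearOrder α] [LinearOrder β] {f : α → β}
    (hf : StrictMono f) {a b c d : α} (hab : a < b) :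
    Ico (f a) (f b) ⊆ Ico (f c) (f d) ↔ Ico a b ⊆ Ico c d := by
  rw [Set.Ico_subset_Ico_iff hab, Set.Ico_subset_Ico_iff (hf hab), hf.le_iff_le, hf.le_iff_le]

theorem StrictMono.Ico_disjoint_Ico_iff {α β : Type*} [LinearOrder α] [LinearOrder β] {f : α → β}
    (hf : StrictMono f) {a b c d : α} :
    Disjoint (Ico (f a) (f b)) (Ico (f c) (f d)) ↔ Disjoint (Ico a b) (Ico c d) := by
  rw [Set.Ico_disjoint_Ico, Set.Ico_disjoint_Ico, ← hf.monotone.map_min, ← hf.monotone.map_max,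
    hf.le_iff_le]

theorem OmegaOneLike.exists_succ {W : Type*} [LinearOrder W] [OmegaOneLike W] (α : W) :
    ∃ α', ∀ ξ, ξ < α' ↔ ξ ≤ α := by
  obtain ⟨β, hβ⟩ := OmegaOneLike.exists_forall_lt (countable_singleton α)
  have hne : (Ioi α).Nonempty := ⟨β, hβ α rfl⟩
  refine ⟨(wellFounded_lt (α := W)).min (Ioi α) hne, fun ξ => ⟨fun h => ?_, fun h => ?_⟩⟩
  · exact not_lt.mp fun h' => (wellFounded_lt (α := W)).not_lt_min (Ioi α) h' h
  · exact h.trans_lt ((wellFounded_lt (α := W)).min_mem (Ioi α) hne)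

open Ordinal in
instance omegaOneLike_omega_one_toType : OmegaOneLike (ω_ 1 : Ordinal.{0}).ToType where
  not_countable h := by
    rw [countable_univ_iff, ← Cardinal.mk_le_aleph0_iff, Cardinal.mk_toType, card_omega] at h
    exact h.not_gt Cardinal.aleph0_lt_aleph_one
  countable_Iio x := by
    rw [← Cardinal.le_aleph0_iff_set_countable, ← Cardinal.lt_aleph_one_iff]
    have h1 : Cardinal.mk (Iio x) =
        (typein (α := (ω_ 1 : Ordinal.{0}).ToType) (· < ·) x).card := rfl
    rw [h1, ← Cardinal.lt_ord, Cardinal.ord_aleph]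
    exact typein_lt_self x

/-! ### The coherent line and its Aronszajn tree -/

section Line

variable {W : Type} [LinearOrder W] [OmegaOneLike W] (E : W → W → ℕ)

/-- The coherent tree, ordered lexicographically. -/
abbrev lexLine : Type := {h : Lex (W → ℕ) // ofLex h ∈ coherentTree E}

/-- The pairs `(g, α)` where `g` is in the coherent tree and `α` is in the support of `g`. They
represent the restriction of `g` to `Iic α`. -/
abbrev Restriction : Type := {i : (W → ℕ) × W // i.1 ∈ coherentTree E ∧ i.1 i.2 ≠ 0}

variable {E} (hE : IsCoherentSeq E)
include hE

theorem IsCoherentSeq.isShortOrder_lexLine : IsShortOrder (lexLine E) := by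
  have : Countable ℕᵒᵈ := inferInstanceAs (Countable ℕ)
  constructor
  · exact hE.noUncountableWO (fun x => ofLex x.1) (fun _ _ h => h) id Function.injective_id
      fun x => x.2
  · refine hE.noUncountableWO (V := ℕᵒᵈ)
      (fun x ξ => OrderDual.toDual (ofLex (OrderDual.ofDual x).1 ξ)) (fun x y h => ?_)
      OrderDual.ofDual OrderDual.ofDual.injective fun x => (OrderDual.ofDual x).2
    obtain ⟨d, hd, hlt⟩ : LexLT (ofLex (OrderDual.ofDual y).1) (ofLex (OrderDual.ofDual x).1) := h
    exact ⟨d, fun γ hγ => congrArg OrderDual.toDual (hd γ hγ).symm, hlt⟩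

theorem IsCoherentSeq.not_countable_lexLine : ¬ Countable (lexLine E) := by
  intro h
  let f : W → lexLine E := fun α => ⟨toLex (E α), α, hE.mem_modifications α⟩
  have hf : f.Injective := fun α β hαβ => by
    have h1 : E α = E β := congrArg (fun x : lexLine E => ofLex x.1) hαβ
    refine eq_of_forall_lt_iff fun ξ => ?_
    rw [← hE.ne_zero_iff, ← hE.ne_zero_iff, h1]
  exact OmegaOneLike.not_countable (Ω := W) (countable_univ_iff.mpr hf.countable)

theorem IsCoherentSeq.mk_lexLine_le (hW : Cardinal.mk W ≤ Cardinal.aleph 1) :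
    Cardinal.mk (lexLine E) ≤ Cardinal.aleph 1 := by
  have h1 : Cardinal.mk (lexLine E) = Cardinal.mk (⋃ α, modifications E α : Set (W → ℕ)) := by
    have : (⋃ α, modifications E α : Set (W → ℕ)) = coherentTree E := by
      ext h
      simp [coherentTree]
    rw [this]
    rfl
  rw [h1]
  refine (Cardinal.mk_iUnion_le _).trans ?_
  refine (mul_le_mul' hW (ciSup_le' fun α =>
    (Cardinal.le_aleph0_iff_set_countable.mpr (hE.countable_modifications α)))).trans ?_
  rw [Cardinal.mul_eq_left (Cardinal.aleph0_le_aleph 1) (Cardinal.aleph0_le_aleph 1)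
    Cardinal.aleph0_ne_zero]

/-- The point of the line given by changing the last value of a restriction to `v`. -/
noncomputable def IsCoherentSeq.point (i : Restriction E) (v : ℕ) (hv : v ≠ 0) : lexLine E :=
  ⟨toLex (node i.1.1 i.1.2 v), by
    obtain ⟨α', hα'⟩ := OmegaOneLike.exists_succ i.1.2
    exact ⟨α', hE.node_mem i.2.1 i.2.2 hα' hv⟩⟩

/-- The half-open interval of the monomial field determined by a restriction. -/
noncomputable def IsCoherentSeq.interval (i : Restriction E) : Set (monomialField (lexLine E)) :=
  Ico (monomialIn (hE.point i (i.1.1 i.1.2) i.2.2))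
    (monomialIn (hE.point i (i.1.1 i.1.2 + 1) (Nat.succ_ne_zero _)))

omit [OmegaOneLike W] hE in
theorem node_self_of_le {g : W → ℕ} {α ξ : W} (h : ξ ≤ α) : node g α (g α) ξ = g ξ := by
  rcases h.eq_or_lt with rfl | h
  · exact node_self
  · exact node_of_lt h

/-- Inclusions are tested in the full lexicographic function space, where an interval consists of
all extensions of a restriction. -/
theorem IsCoherentSeq.interval_subset_iff (i j : Restriction E) :
    hE.interval j ⊆ hE.interval i ↔ i.1.2 ≤ j.1.2 ∧ ∀ ξ ≤ i.1.2, i.1.1 ξ = j.1.1 ξ := by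
  have hlt : hE.point j (j.1.1 j.1.2) j.2.2 < hE.point j (j.1.1 j.1.2 + 1) (Nat.succ_ne_zero _) :=
    node_lt_node
  rw [interval, interval, monomialIn_strictMono.Ico_subset_Ico_iff hlt,
    ← (Subtype.strictMono_coe _).Ico_subset_Ico_iff hlt]
  constructor
  · intro h
    have h1 := mem_Ico_node_iff.mp (h (mem_Ico_node_iff.mpr fun ξ hξ => node_self_of_le hξ))
    have h2 : i.1.2 ≤ j.1.2 := by
      by_contra! h3
      have h4 := h1 _ le_rfl
      rw [node_of_gt h3] at h4
      exact i.2.2 h4.symm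
    exact ⟨h2, fun ξ hξ => (h1 ξ hξ).symm.trans (node_self_of_le (hξ.trans h2))⟩
  · rintro ⟨h1, h2⟩ h hh
    refine mem_Ico_node_iff.mpr fun ξ hξ => ?_
    rw [h2 ξ hξ]
    exact mem_Ico_node_iff.mp hh ξ (hξ.trans h1)

/-- Two restrictions of one function are comparable. -/
theorem IsCoherentSeq.interval_disjoint (i j : Restriction E)
    (hij : ¬ hE.interval i ⊆ hE.interval j) (hji : ¬ hE.interval j ⊆ hE.interval i) :
    Disjoint (hE.interval i) (hE.interval j) := by
  by_contra hd
  rw [interval, interval, monomialIn_strictMono.Ico_disjoint_Ico_iff,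
    ← (Subtype.strictMono_coe _).Ico_disjoint_Ico_iff, not_disjoint_iff] at hd
  obtain ⟨h, h1, h2⟩ := hd
  have h1' := mem_Ico_node_iff.mp h1
  have h2' := mem_Ico_node_iff.mp h2
  rcases le_total i.1.2 j.1.2 with hle | hle
  · exact hji ((hE.interval_subset_iff i j).mpr
      ⟨hle, fun ξ hξ => (h1' ξ hξ).symm.trans (h2' ξ (hξ.trans hle))⟩)
  · exact hij ((hE.interval_subset_iff j i).mpr
      ⟨hle, fun ξ hξ => (h2' ξ hξ).symm.trans (h1' ξ (hξ.trans hle))⟩)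

theorem IsCoherentSeq.interval_mem_intervalAlgebra (i : Restriction E) :
    hE.interval i ∈ intervalAlgebra (monomialField (lexLine E)) := by
  refine BooleanSubalgebra.subset_closure ⟨_, _, monomialIn_strictMono ?_, rfl⟩
  exact node_lt_node

theorem IsCoherentSeq.isAronszajnTree
    (hW : Ordinal.type (fun a b : W => a < b) = Ordinal.omega 1) :
    IsAronszajnTree (range hE.interval)ᵒᵈ := by
  have hidx : ∀ x : (range hE.interval)ᵒᵈ, ∃ i, hE.interval i = (OrderDual.ofDual x).1 :=
    fun x => (OrderDual.ofDual x).2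
  choose I hI using hidx
  have hle : ∀ x y, x ≤ y ↔ (I x).1.2 ≤ (I y).1.2 ∧ ∀ ξ ≤ (I x).1.2, (I x).1.1 ξ = (I y).1.1 ξ := by
    intro x y
    rw [← hE.interval_subset_iff, hI, hI]
    rfl
  -- Many pairs give the same interval; the chosen representative has the same restriction.
  have hex : ∀ j : Restriction E, ∃ x, (I x).1.2 = j.1.2 ∧ ∀ ξ ≤ j.1.2, (I x).1.1 ξ = j.1.1 ξ := by
    intro j
    let x : (range hE.interval)ᵒᵈ := OrderDual.toDual ⟨hE.interval j, j, rfl⟩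
    have h : hE.interval (I x) = hE.interval j := hI x
    have h1 := (hE.interval_subset_iff (I x) j).mp h.ge
    have h2 := (hE.interval_subset_iff j (I x)).mp h.le
    exact ⟨x, le_antisymm h1.1 h2.1, fun ξ hξ => (h2.2 ξ hξ).symm⟩
  refine isAronszajnTree_of_labels hW (fun x => (I x).1.2) (fun x => (I x).1.1) hle ?_ ?_ ?_ ?_
  · intro y α hα
    obtain ⟨x, hx, hx'⟩ := hex ⟨((I y).1.1, α), (I y).2.1, ne_zero_of_le (I y).2.1 (I y).2.2 hα⟩
    refine ⟨x, (hle x y).mpr ⟨hx.trans_le hα, fun ξ hξ => hx' ξ (hξ.trans hx.le)⟩, hx⟩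
  · intro α
    obtain ⟨α', hα'⟩ := OmegaOneLike.exists_succ α
    -- Level `α` embeds into the modifications of `E α'`, where `α'` is the successor of `α`.
    refine MapsTo.countable_of_injOn (f := fun x => node (I x).1.1 α ((I x).1.1 α)) ?_ ?_
      (hE.countable_modifications α')
    · rintro x rfl
      exact hE.node_mem (I x).2.1 (I x).2.2 hα' (I x).2.2
    · intro x hx y hy hxy
      have hx : (I x).1.2 = α := hx
      have hy : (I y).1.2 = α := hy
      have h : ∀ ξ ≤ α, (I x).1.1 ξ = (I y).1.1 ξ := fun ξ hξ => by
        rw [← node_self_of_le (g := (I x).1.1) hξ, ← node_self_of_le (g := (I y).1.1) hξ]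
        exact congrFun hxy ξ
      refine le_antisymm ((hle x y).mpr ⟨(hx.trans hy.symm).le, fun ξ hξ => h ξ (hξ.trans hx.le)⟩)
        ((hle y x).mpr ⟨(hy.trans hx.symm).le, fun ξ hξ => (h ξ (hξ.trans hy.le)).symm⟩)
  · intro α
    obtain ⟨α', hα'⟩ := OmegaOneLike.exists_succ α
    obtain ⟨x, hx, -⟩ := hex ⟨(E α', α), ⟨α', hE.mem_modifications α'⟩,
      (hE.ne_zero_iff α' α).mpr ((hα' α).mpr le_rfl)⟩
    exact ⟨x, hx⟩
  · intro G H
    refine hE.no_branch G fun δ => ?_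
    obtain ⟨x, hδ, hx⟩ := H δ
    exact ⟨_, (I x).2.1, fun γ hγ => ⟨hx γ hγ.le,
      ne_zero_of_le (I x).2.1 (I x).2.2 (hγ.le.trans hδ)⟩⟩

end Line

/-! ### Cardinality and conclusion -/

theorem mk_monomialField {A : Type} [LinearOrder A] (hA : ¬ Countable A)
    (hA' : Cardinal.mk A ≤ Cardinal.aleph 1) :
    Cardinal.mk (monomialField A) = Cardinal.aleph 1 := by
  refine le_antisymm ((Subfield.cardinalMk_closure_le_max _).trans (max_le ?_ ?_)) ?_
  · exact Cardinal.mk_range_le.trans hA'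
  · exact Cardinal.aleph0_le_aleph 1
  · by_contra! h
    rw [Cardinal.lt_aleph_one_iff, Cardinal.mk_le_aleph0_iff] at h
    exact hA (monomialIn_strictMono (A := A)).injective.countable

theorem uncountable_Iio_omega_one : Uncountable (Iio (Ordinal.omega.{0} 1)) := by
  rw [← not_countable_iff]
  intro h
  have := Ordinal.ToType.mk.{0}.symm.injective.countable (α := (Ordinal.omega.{0} 1).ToType)
  exact OmegaOneLike.not_countable (countable_univ_iff.mpr this)

theorem lemma3p9 :
    ∃ (L : Type) (_ : LinearOrder L),
      DenselyOrdered L ∧ NoMinOrder L ∧ NoMaxOrder L ∧ Cardinal.mk L = Cardinal.aleph 1 ∧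
      -- no strictly increasing or strictly decreasing sequences of length `ω₁`
      (¬ ∃ f : Set.Iio (Ordinal.omega.{0} 1) → L, StrictMono f) ∧
      (¬ ∃ f : Set.Iio (Ordinal.omega.{0} 1) → L, StrictAnti f) ∧
      -- isomorphic to each nonempty open interval
      (∀ s : Set L, IsOpenInterval s → s.Nonempty → Nonempty (L ≃o s)) ∧
      ¬ IsCCCOrder L ∧
      -- a subset of the interval algebra which is an Aronszajn tree under reverse inclusion,
      -- with incomparable elements disjoint
      (∃ S : Set (Set L), S ⊆ (intervalAlgebra L : Set (Set L)) ∧ IsAronszajnTree (↥S)ᵒᵈ ∧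
        ∀ a ∈ S, ∀ b ∈ S, ¬ a ⊆ b → ¬ b ⊆ a → Disjoint a b) := by
  obtain ⟨E, hE⟩ := exists_isCoherentSeq (Ordinal.omega.{0} 1).ToType
  have hshort : IsShortOrder (monomialField (lexLine E)) :=
    hE.isShortOrder_lexLine.hahnLexField.of_strictMono (Subtype.strictMono_coe _)
  refine ⟨monomialField (lexLine E), inferInstance, inferInstance, inferInstance, inferInstance,
    mk_monomialField hE.not_countable_lexLine (hE.mk_lexLine_le ?_),
    hshort.not_strictMono uncountable_Iio_omega_one,
    hshort.not_strictAnti uncountable_Iio_omega_one,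
    fun s hs hne => hs.nonempty_orderIso hne,
    not_isCCCOrder_monomialField hE.not_countable_lexLine, range hE.interval, ?_,
    hE.isAronszajnTree (Ordinal.type_toType _), ?_⟩
  · rw [Cardinal.mk_toType, Ordinal.card_omega]
  · rintro _ ⟨i, rfl⟩
    exact hE.interval_mem_intervalAlgebra i
  · rintro _ ⟨i, rfl⟩ _ ⟨j, rfl⟩
    exact hE.interval_disjoint i j
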